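/- Let $\mathbb F_q$ be a finite field with $q\ge 9$ elements. For $r,m\ge 1$ let $R_q(r,m)$ be the generalized Reed-Muller code: the set of functions $f:\mathbb F_q^m\to\mathbb F_q$ whose reduced form (the unique polynomial of degree at most $q-1$ in each variable inducing $f$) has total degree at most $r$. The weight $|f|$ is the number of points of $\mathbb F_q^m$ at which $f$ is nonzero, and the third weight of a code is the third smallest element of the set of weights of its nonzero codewords. Then the third weight $c_4$ of $R_q(4,2)$ is $$c_4=(q-2)^2 .$$ Furthermore, if $f\in R_q(4,2)$ satisfies $|f|=(q-2)^2$, then there is an invertible affine transformation $T$ of $\mathbb F_q^2$ such that either, for all $(x,y)\in\mathbb F_q^2$, $$f(T(x,y))=\lambda\,(x-a)(x-b)(y-c)(y-d)$$ for some $\lambda\in\mathbb F_q^*$ and $a,b,c,d\in\mathbb F_q$ with $a\ne b$ and $c\ne d$, or, for all $(x,y)\in\mathbb F_q^2$, $$f(T(x,y))=\Bigl(\prod_{i=1}^{3}(a_ix+b_iy)\Bigr)(a_1x+b_1y+e)$$ for some $(a_i,b_i)\in\mathbb F_q^2\setminus\{(0,0)\}$ ($i=1,2,3$) with $a_ib_j-a_jb_i\ne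 0$ for $i\ne j$, and some $e\in\mathbb F_q^*$. -/

import Mathlib

/-- The generalized Reed-Muller code `R_q(r, m)` over a finite field `F` with `q` elements:
the functions `F ^ m → F` whose reduced form (the polynomial of degree at most `q - 1` in each
variable that induces the function) has total degree at most `r`. -/
noncomputable def reedMuller (F : Type*) [Field F] [Fintype F] (r m : ℕ) :
    Submodule F ((Fin m → F) → F) :=
  (MvPolynomial.restrictDegree (Fin m) F (Fintype.card F - 1) ⊓
    MvPolynomial.restrictTotalDegree (Fin m) F r).map (MvPolynomial.evalₗ F (Fin m))

/-- The weight `|f|`: the number of points of the support of `f`. -/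
noncomputable def weight {F : Type*} [Field F] {m : ℕ} (f : (Fin m → F) → F) : ℕ :=
  (Function.support f).ncard

/-- `w` is the weight of a nonzero codeword of `R_q(r, m)`. -/
def IsWeight (F : Type*) [Field F] [Fintype F] (r m w : ℕ) : Prop :=
  ∃ f ∈ reedMuller F r m, f ≠ 0 ∧ weight f = w

/-- The third weight of `R_q(r, m)`: the third smallest among the weights of its nonzero
codewords. (`Nat.nth` counts from `0`; its value is `0`, which is not the weight of a nonzero
codeword, if there are fewer than three weights.) -/
noncomputable def thirdWeight (F : Type*) [Field F] [Fintype F] (r m : ℕ) : ℕ :=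
  Nat.nth (IsWeight F r m) 2

/-! Weights are complements in `q²` of zero counts, so the claim is that a nonzero quartic function
has `4q`, `4q - 3`, `4q - 4` (two configurations only) or at most `4q - 5` zeros.

If a function of degree at most `d + 1` vanishes on no line, the `q + 1` lines through one of its
zeros carry at most `d + 1 + qd` zeros (`IsPolyFun.zeroCount_le_or`); otherwise a line factors off,
at a cost of at most `q` zeros. Iterating, a quartic either has at most `3q + 4` zeros or is a
product of four lines. The inequality `3q + 4 ≤ 4q - 5` is exactly `q ≥ 9`.

For products of four distinct lines, an affine change of coordinates turns two transversal lines
into the axes. Four parallel lines give `4q`. Three parallel lines with a transversal, or four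
concurrent lines, give `4q - 3`. Two pairs of parallels, or three concurrent lines with a parallel
to one of them, give `4q - 4`. All other arrangements have at least two further coincidences
(`zeroCount_le_of_fibers`), and repeated lines leave at most `3q` zeros.

Products of lines parallel to the axes attain the weights `q(q - 4)`, `(q - 1)(q - 3)` and `(q -
2)²`, so the last is third. -/

/-- Functions on the affine plane given by a polynomial of total degree at most `d`. -/
def IsPolyFun {F : Type*} [Field F] (d : ℕ) (f : (Fin 2 → F) → F) : Prop :=
  ∃ p : MvPolynomial (Fin 2) F, p.totalDegree ≤ d ∧ ∀ v, f v = MvPolynomial.eval v p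

/-- Nonconstant affine forms on the affine plane. -/
def IsLine {F : Type*} [Field F] (g : (Fin 2 → F) → F) : Prop :=
  ∃ a b c : F, (a ≠ 0 ∨ b ≠ 0) ∧ ∀ v, g v = a * v 0 + b * v 1 + c

/-! ### Affine changes of coordinates and division by a line -/

section Poly

variable {F : Type*} [Field F]

theorem affineEquiv_coord (T : (Fin 2 → F) ≃ᵃ[F] (Fin 2 → F)) :
    ∃ (M : Fin 2 → Fin 2 → F) (c : Fin 2 → F),
      ∀ v i, T v i = M i 0 * v 0 + M i 1 * v 1 + c i := by
  refine ⟨fun i j => T.linear (Pi.single j 1) i, T 0, fun v i => ?_⟩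
  have h1 : T v = T.linear v + T 0 := by
    have := T.map_vadd 0 v
    simpa using this
  have h2 : v = v 0 • (Pi.single 0 1 : Fin 2 → F) + v 1 • (Pi.single 1 1 : Fin 2 → F) := by
    ext j
    fin_cases j <;> simp
  rw [h1]
  conv_lhs => rw [h2]
  simp only [map_add, map_smul, Pi.add_apply, Pi.smul_apply, smul_eq_mul]
  ring

/-- Cramer's rule inverts the map given by the two forms. This is what turns two transversal lines
into the coordinate axes. -/
theorem exists_affineEquiv (a b c a' b' c' : F) (h : a * b' - a' * b ≠ 0) :
    ∃ T : (Fin 2 → F) ≃ᵃ[F] (Fin 2 → F), ∀ v,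
      a * T v 0 + b * T v 1 + c = v 0 ∧ a' * T v 0 + b' * T v 1 + c' = v 1 := by
  set D := a * b' - a' * b with hD
  let e : (Fin 2 → F) ≃ₗ[F] (Fin 2 → F) :=
    { toFun := fun v => ![(b' * v 0 - b * v 1) / D, (a * v 1 - a' * v 0) / D]
      invFun := fun v => ![a * v 0 + b * v 1, a' * v 0 + b' * v 1]
      map_add' := fun v w => by
        ext i
        fin_cases i <;> simp <;> ring
      map_smul' := fun r v => by
        ext i
        fin_cases i <;> simp <;> ring
      left_inv := fun v => by
        ext i
        fin_cases i <;> simp <;> field_simp <;> rw [hD] <;> ring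
      right_inv := fun v => by
        ext i
        fin_cases i <;> simp <;> field_simp <;> rw [hD] <;> ring }
  refine ⟨(AffineEquiv.constVAdd F (Fin 2 → F) ![-c, -c']).trans e.toAffineEquiv, fun v => ?_⟩
  simp [e, Matrix.vecHead, Matrix.vecTail]
  constructor <;> field_simp <;> rw [hD] <;> ring

theorem IsLine.comp {g : (Fin 2 → F) → F} (hg : IsLine g)
    (T : (Fin 2 → F) ≃ᵃ[F] (Fin 2 → F)) : IsLine (fun v => g (T v)) := by
  obtain ⟨a, b, c, hab, h⟩ := hg
  obtain ⟨M, k, hM⟩ := affineEquiv_coord T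
  refine ⟨a * M 0 0 + b * M 1 0, a * M 0 1 + b * M 1 1, a * k 0 + b * k 1 + c, ?_,
    fun v => by simp only [h, hM]; ring⟩
  -- Were both linear coefficients zero, `g ∘ T`, and by surjectivity of `T` also `g`, would be
  -- constant.
  by_contra! h0
  have hconst : ∀ v w, g (T v) = g (T w) := fun v w => by
    simp only [h, hM]
    linear_combination h0.1 * (v 0 - w 0) + h0.2 * (v 1 - w 1)
  have hconst' : ∀ v w, g v = g w := fun v w => by
    simpa using hconst (T.symm v) (T.symm w)
  have h1 := hconst' ![1, 0] ![0, 0]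
  have h2 := hconst' ![0, 1] ![0, 0]
  simp [h] at h1 h2
  tauto

theorem isLine_of_coeff (a b c : F) (h : a ≠ 0 ∨ b ≠ 0) :
    IsLine (fun v => a * v 0 + b * v 1 + c) := ⟨a, b, c, h, fun _ => rfl⟩

theorem isLine_fst_sub (a : F) : IsLine (fun v => v 0 - a) :=
  ⟨1, 0, -a, Or.inl one_ne_zero, fun v => by ring⟩

theorem isLine_snd_sub (a : F) : IsLine (fun v => v 1 - a) :=
  ⟨0, 1, -a, Or.inr one_ne_zero, fun v => by ring⟩

theorem isPolyFun_const (d : ℕ) (c : F) : IsPolyFun d (fun _ => c) :=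
  ⟨MvPolynomial.C c, by simp, by simp⟩

theorem IsLine.isPolyFun {g : (Fin 2 → F) → F} (hg : IsLine g) : IsPolyFun 1 g := by
  obtain ⟨a, b, c, -, h⟩ := hg
  refine ⟨MvPolynomial.C a * MvPolynomial.X 0 + MvPolynomial.C b * MvPolynomial.X 1 +
    MvPolynomial.C c, ?_, fun v => by simp [h]⟩
  have hX : ∀ (r : F) (i : Fin 2), (MvPolynomial.C r * MvPolynomial.X i).totalDegree ≤ 1 :=
    fun r i => (MvPolynomial.totalDegree_mul _ _).trans (by simp)
  refine (MvPolynomial.totalDegree_add _ _).trans (max_le ?_ (by simp))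
  exact (MvPolynomial.totalDegree_add _ _).trans (max_le (hX _ _) (hX _ _))

theorem IsPolyFun.mul {d e : ℕ} {f g : (Fin 2 → F) → F} (hf : IsPolyFun d f)
    (hg : IsPolyFun e g) : IsPolyFun (d + e) (fun v => f v * g v) := by
  obtain ⟨p, hp, hpf⟩ := hf
  obtain ⟨q, hq, hqg⟩ := hg
  exact ⟨p * q, (MvPolynomial.totalDegree_mul _ _).trans (add_le_add hp hq),
    fun v => by simp [hpf, hqg]⟩

theorem IsPolyFun.comp {d : ℕ} {f : (Fin 2 → F) → F} (hf : IsPolyFun d f)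
    (T : (Fin 2 → F) ≃ᵃ[F] (Fin 2 → F)) : IsPolyFun d (fun v => f (T v)) := by
  obtain ⟨p, hp, hpf⟩ := hf
  obtain ⟨M, k, hM⟩ := affineEquiv_coord T
  have hT : ∀ i, ∃ l : MvPolynomial (Fin 2) F, l.totalDegree ≤ 1 ∧
      ∀ v, T v i = MvPolynomial.eval v l := fun i => by
    by_cases h : M i 0 ≠ 0 ∨ M i 1 ≠ 0
    · exact IsLine.isPolyFun ⟨M i 0, M i 1, k i, h, fun v => hM v i⟩
    · push Not at h
      exact ⟨MvPolynomial.C (k i), by simp, fun v => by simp [hM, h.1, h.2]⟩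
  choose l hl hlT using hT
  refine ⟨MvPolynomial.bind₁ l p, ?_, fun v => ?_⟩
  · rw [← MvPolynomial.aeval_eq_bind₁, MvPolynomial.aeval_def, MvPolynomial.eval₂]
    refine MvPolynomial.totalDegree_finsetSum_le fun s hs => ?_
    refine (MvPolynomial.totalDegree_mul _ _).trans ?_
    rw [MvPolynomial.algebraMap_eq, MvPolynomial.totalDegree_C, zero_add]
    refine (MvPolynomial.totalDegree_finsetProd _ _).trans ?_
    refine le_trans (Finset.sum_le_sum fun i _ => ?_)
      ((MvPolynomial.le_totalDegree hs).trans hp)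
    exact (MvPolynomial.totalDegree_pow _ _).trans (by nlinarith [hl i])
  · simp only [hpf]
    rw [← MvPolynomial.aeval_eq_eval, ← MvPolynomial.aeval_eq_eval, MvPolynomial.aeval_bind₁]
    congr 2
    ext i
    rw [MvPolynomial.aeval_eq_eval, hlT]

/-- The restriction of a plane polynomial function to a parametrized line. -/
theorem IsPolyFun.restrict {d : ℕ} {f : (Fin 2 → F) → F} (hf : IsPolyFun d f) (a b : F) :
    ∃ p : Polynomial F, p.natDegree ≤ d ∧ ∀ t, f ![a * t, b * t] = p.eval t := by
  obtain ⟨p, hp, hpf⟩ := hf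
  let l : Fin 2 → Polynomial F := ![Polynomial.C a * Polynomial.X, Polynomial.C b * Polynomial.X]
  refine ⟨MvPolynomial.aeval l p, ?_, fun t => ?_⟩
  · refine (MvPolynomial.aeval_natDegree_le p hp l (n := 1) fun i => ?_).trans (by simp)
    fin_cases i
    all_goals exact (Polynomial.natDegree_C_mul_le _ _).trans Polynomial.natDegree_X_le
  · rw [hpf, ← MvPolynomial.aeval_eq_eval, ← Polynomial.coe_aeval_eq_eval,
      MvPolynomial.comp_aeval_apply]
    congr 2
    ext i
    fin_cases i <;> simp [l]

/-- A polynomial function vanishing on the line `x = 0` is divisible by `x`. -/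
theorem IsPolyFun.exists_eq_fst_mul {d : ℕ} {f : (Fin 2 → F) → F} (hf : IsPolyFun (d + 1) f)
    (h0 : ∀ t, f ![0, t] = 0) : ∃ g, IsPolyFun d g ∧ ∀ v, f v = v 0 * g v := by
  classical
  obtain ⟨p, hp, hpf⟩ := hf
  let S := p.support.filter fun s => s 0 ≠ 0
  let g : MvPolynomial (Fin 2) F :=
    ∑ s ∈ S, MvPolynomial.monomial (s - Finsupp.single 0 1) (p.coeff s)
  -- The monomials containing `x` are divided by `x`; the others add up to `f (0, y)`, which only
  -- has to vanish as a function, so no bound on the degree in terms of `q` is needed.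
  have key : ∀ v : Fin 2 → F, f v = v 0 * MvPolynomial.eval v g + f ![0, v 1] := fun v => by
    rw [hpf, hpf, MvPolynomial.eval_eq' v p, MvPolynomial.eval_eq' _ p, map_sum, Finset.mul_sum,
      Finset.sum_filter, ← Finset.sum_add_distrib]
    refine Finset.sum_congr rfl fun s _ => ?_
    simp only [Fin.prod_univ_two, MvPolynomial.eval_monomial]
    split_ifs with h
    · obtain ⟨n, hn⟩ := Nat.exists_eq_succ_of_ne_zero h
      rw [Finsupp.prod_fintype _ _ (by simp)]
      simp [hn, pow_succ]
      ring
    · push Not at h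
      simp [h]
  refine ⟨fun v => MvPolynomial.eval v g, ⟨g, ?_, fun _ => rfl⟩, fun v => by
    rw [key v, h0, add_zero]⟩
  refine MvPolynomial.totalDegree_finsetSum_le fun s hs => ?_
  refine (MvPolynomial.totalDegree_monomial_le _ _).trans ?_
  have hs' := Finset.mem_filter.1 hs
  have h1 := (MvPolynomial.le_totalDegree hs'.1).trans hp
  have h2 := hs'.2
  rw [Finsupp.sum_fintype _ _ (by simp), Fin.sum_univ_two] at h1 ⊢
  simp
  omega

/-- For `d < q`, a total degree at most `d` already bounds each variable's degree by `q - 1`, so the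
polynomial is automatically reduced. -/
theorem mem_reedMuller_iff [Fintype F] {d : ℕ} (hd : d < Fintype.card F)
    {f : (Fin 2 → F) → F} : f ∈ reedMuller F d 2 ↔ IsPolyFun d f := by
  constructor
  · rintro ⟨p, ⟨-, hp⟩, rfl⟩
    exact ⟨p, (MvPolynomial.mem_restrictTotalDegree _ _ _).1 hp, fun v => rfl⟩
  · rintro ⟨p, hp, hpf⟩
    refine ⟨p, ⟨?_, (MvPolynomial.mem_restrictTotalDegree _ _ _).2 hp⟩, ?_⟩
    · refine (MvPolynomial.mem_restrictDegree _ _ _).2 fun s hs i => ?_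
      have := MvPolynomial.degreeOf_le_iff.1
        ((MvPolynomial.degreeOf_le_totalDegree p i).trans hp) s hs
      omega
    · exact funext fun v => (hpf v).symm

end Poly

/-! ### Counting zeros and splitting off lines -/

/-- The number of zeros of a function on the affine plane. -/
noncomputable def zeroCount {F : Type*} [Field F] (f : (Fin 2 → F) → F) : ℕ :=
  {v | f v = 0}.ncard

section Count

variable {F : Type*} [Field F]

theorem IsLine.exists_comp_eq_fst {g : (Fin 2 → F) → F} (hg : IsLine g) :
    ∃ T : (Fin 2 → F) ≃ᵃ[F] (Fin 2 → F), ∀ v, g (T v) = v 0 := by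
  obtain ⟨a, b, c, hab, h⟩ := hg
  rcases hab with ha | hb
  · obtain ⟨T, hT⟩ := exists_affineEquiv a b c 0 1 0 (by simpa using ha)
    exact ⟨T, fun v => by rw [h, (hT v).1]⟩
  · obtain ⟨T, hT⟩ := exists_affineEquiv a b c 1 0 0 (by simpa using hb)
    exact ⟨T, fun v => by rw [h, (hT v).1]⟩

theorem zeroCount_comp (f : (Fin 2 → F) → F) (T : (Fin 2 → F) ≃ᵃ[F] (Fin 2 → F)) :
    zeroCount (fun v => f (T v)) = zeroCount f := by
  refine Set.ncard_congr (fun v _ => T v) (fun v hv => hv) (fun v w _ _ h => T.injective h)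
    fun w hw => ⟨T.symm w, by simpa using hw, by simp⟩

theorem zeroCount_congr {f g : (Fin 2 → F) → F} (h : ∀ v, f v = g v) :
    zeroCount f = zeroCount g := by
  rw [funext h]

/-- A plane polynomial function of degree at most `d + 1` vanishing on a line is divisible by
an equation of the line. -/
theorem IsPolyFun.exists_eq_line_mul {d : ℕ} {f l : (Fin 2 → F) → F} (hf : IsPolyFun (d + 1) f)
    (hl : IsLine l) (h0 : ∀ v, l v = 0 → f v = 0) :
    ∃ g, IsPolyFun d g ∧ ∀ v, f v = l v * g v := by
  obtain ⟨T, hT⟩ := hl.exists_comp_eq_fst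
  obtain ⟨g, hg, hfg⟩ := (hf.comp T).exists_eq_fst_mul fun t => h0 _ (by simp [hT])
  refine ⟨_, hg.comp T.symm, fun v => ?_⟩
  have := hfg (T.symm v)
  rw [← hT (T.symm v)] at this
  simpa using this

variable [Fintype F]

theorem weight_add_zeroCount (f : (Fin 2 → F) → F) :
    weight f + zeroCount f = Fintype.card F ^ 2 := by
  have h : {v | f v = 0} = (Function.support f)ᶜ := by
    ext v
    simp
  rw [weight, zeroCount, h, Set.ncard_add_ncard_compl]
  simp [Nat.card_eq_fintype_card]

theorem zeroCount_mul_le (f g : (Fin 2 → F) → F) :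
    zeroCount (fun v => f v * g v) ≤ zeroCount f + zeroCount g := by
  refine le_trans (Set.ncard_le_ncard ?_) (Set.ncard_union_le _ _)
  intro v hv
  simpa using hv

theorem zeroCount_mono {f g : (Fin 2 → F) → F} (h : ∀ v, f v = 0 → g v = 0) :
    zeroCount f ≤ zeroCount g :=
  Set.ncard_le_ncard h

theorem zeroCount_eq_sum (f : (Fin 2 → F) → F) :
    zeroCount f = ∑ x, {y | f ![x, y] = 0}.ncard := by
  classical
  simp only [zeroCount, Set.ncard_eq_toFinset_card', Set.toFinset_ofPred, Finset.card_filter]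
  rw [← Equiv.sum_comp (finTwoArrowEquiv F).symm, Fintype.sum_prod_type]
  rfl

theorem IsLine.zeroCount_eq {g : (Fin 2 → F) → F} (hg : IsLine g) :
    zeroCount g = Fintype.card F := by
  classical
  obtain ⟨T, hT⟩ := hg.exists_comp_eq_fst
  rw [← zeroCount_comp g T, zeroCount_congr hT, zeroCount_eq_sum]
  rw [Finset.sum_eq_single 0]
  · simp [Set.ncard_univ, Nat.card_eq_fintype_card]
  · intro x _ hx
    simp [hx]
  · simp

/-- Either a plane polynomial function is divisible by a line, or counting along the lines
through one of its zeros bounds the number of zeros. -/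
theorem IsPolyFun.zeroCount_le_or {d : ℕ} {f : (Fin 2 → F) → F} (hf : IsPolyFun (d + 1) f) :
    zeroCount f ≤ d + 1 + Fintype.card F * d ∨
      ∃ l g, IsLine l ∧ IsPolyFun d g ∧ ∀ v, f v = l v * g v := by
  classical
  by_cases hline : ∃ l, IsLine l ∧ ∀ v, l v = 0 → f v = 0
  · obtain ⟨l, hl, h0⟩ := hline
    obtain ⟨g, hg, h⟩ := hf.exists_eq_line_mul hl h0
    exact Or.inr ⟨l, g, hl, hg, h⟩
  left
  by_cases hz : ∃ P, f P = 0
  swap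
  · push Not at hz
    simp [zeroCount, hz]
  obtain ⟨P, hP⟩ := hz
  -- Translating the zero `P` to the origin makes the lines through it the vertical axis and the
  -- lines `y = t x`.
  let T : (Fin 2 → F) ≃ᵃ[F] (Fin 2 → F) := AffineEquiv.constVAdd F (Fin 2 → F) P
  have hline' : ∀ l, IsLine l → ∃ v, l v = 0 ∧ f (T v) ≠ 0 := fun l hl => by
    by_contra! h
    exact hline ⟨_, hl.comp T.symm, fun v hv => by simpa using h _ hv⟩
  have hf' := hf.comp T
  have hP' : f (T ![0, 0]) = 0 := by
    have : T ![0, 0] = P := by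
      ext i
      fin_cases i <;> simp [T]
    rw [this, hP]
  rw [← zeroCount_comp f T]
  have hroots : ∀ p : Polynomial F, p.natDegree ≤ d + 1 → p.roots.toFinset.card ≤ d + 1 :=
    fun p hp => (Multiset.toFinset_card_le _).trans ((Polynomial.card_roots' p).trans hp)
  obtain ⟨p, hp, hpf⟩ := hf'.restrict 0 1
  choose r hr hrf using fun t => hf'.restrict 1 t
  have hp0 : p ≠ 0 := by
    rintro rfl
    obtain ⟨v, hv, hfv⟩ := hline' _ (isLine_fst_sub 0)
    refine hfv ?_
    have h1 := hpf (v 1)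
    have h2 : v = ![0 * v 1, 1 * v 1] := by
      ext i
      fin_cases i
      · simpa using hv
      · simp
    rw [← h2] at h1
    simpa using h1
  have hr0 : ∀ t, r t ≠ 0 := fun t h => by
    obtain ⟨v, hv, hfv⟩ := hline' _ (isLine_of_coeff (-t) 1 0 (Or.inr one_ne_zero))
    refine hfv ?_
    have h1 := hrf t (v 0)
    have h2 : v = ![1 * v 0, t * v 0] := by
      ext i
      fin_cases i
      · simp
      · simp
        linear_combination hv
    rw [← h2, h] at h1
    simpa using h1
  -- The origin is kept in `A` and erased from every `B t`, so it is counted once: `d + 1` points on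
  -- the vertical axis and `d` on each of the `q` other lines.
  let A : Finset (Fin 2 → F) := p.roots.toFinset.image fun y => ![0, y]
  let B : F → Finset (Fin 2 → F) := fun t =>
    ((r t).roots.toFinset.erase 0).image fun x => ![x, t * x]
  have hA : A.card ≤ d + 1 := Finset.card_image_le.trans (hroots p hp)
  have hB : ∀ t, (B t).card ≤ d := fun t => by
    refine Finset.card_image_le.trans ?_
    rw [Finset.card_erase_of_mem]
    · have := hroots (r t) (hr t)
      omega
    · have := hrf t 0
      simp only [mul_zero, hP'] at this
      simp [hr0 t, ← this]
  have hsub : {v | f (T v) = 0} ⊆ ↑(A ∪ Finset.univ.biUnion B) := by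
    intro v hv
    have hv' : f (T v) = 0 := hv
    simp only [Finset.coe_union, Set.mem_union, Finset.mem_coe, A, B, Finset.mem_image,
      Finset.mem_biUnion, Finset.mem_univ, true_and, Finset.mem_erase, Multiset.mem_toFinset]
    by_cases h0 : v 0 = 0
    · have h2 : v = ![0 * v 1, 1 * v 1] := by
        ext i
        fin_cases i <;> simp [h0]
      refine Or.inl ⟨v 1, ?_, ?_⟩
      · rw [Polynomial.mem_roots hp0, Polynomial.IsRoot.def, ← hpf, ← h2, hv']
      · rw [h2]
        simp
    · have h2 : v = ![1 * v 0, v 1 / v 0 * v 0] := by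
        ext i
        fin_cases i <;> simp [h0]
      refine Or.inr ⟨v 1 / v 0, v 0, ⟨h0, ?_⟩, ?_⟩
      · rw [Polynomial.mem_roots (hr0 _), Polynomial.IsRoot.def, ← hrf, ← h2, hv']
      · conv_rhs => rw [h2]
        simp
  refine (Set.ncard_le_ncard hsub).trans ?_
  rw [Set.ncard_coe_finset]
  refine (Finset.card_union_le _ _).trans (add_le_add hA ?_)
  refine Finset.card_biUnion_le.trans ((Finset.sum_le_sum fun t _ => hB t).trans ?_)
  simp

/-- A nonzero function of degree at most four with many zeros is a product of four lines. -/
theorem IsPolyFun.zeroCount_le_or_eq_prod_lines {f : (Fin 2 → F) → F} (hf : IsPolyFun 4 f)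
    (h0 : f ≠ 0) : zeroCount f ≤ 3 * Fintype.card F + 4 ∨
      ∃ (c : F) (l₁ l₂ l₃ l₄ : (Fin 2 → F) → F), c ≠ 0 ∧ IsLine l₁ ∧ IsLine l₂ ∧ IsLine l₃ ∧
        IsLine l₄ ∧ ∀ v, f v = c * (l₁ v * l₂ v * l₃ v * l₄ v) := by
  have hmul : ∀ {f l g : (Fin 2 → F) → F}, IsLine l → (∀ v, f v = l v * g v) →
      zeroCount f ≤ Fintype.card F + zeroCount g := fun {f l g} hl h => by
    rw [zeroCount_congr h, ← hl.zeroCount_eq]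
    exact zeroCount_mul_le l g
  -- Stopping after `j` lines gives at most `jq + (4 - j) + (3 - j)q = 3q + 4 - j` zeros.
  rcases hf.zeroCount_le_or with h | ⟨l₁, g₁, hl₁, hg₁, h₁⟩
  · left; omega
  have e₁ := hmul hl₁ h₁
  rcases hg₁.zeroCount_le_or with h | ⟨l₂, g₂, hl₂, hg₂, h₂⟩
  · left; omega
  have e₂ := hmul hl₂ h₂
  rcases hg₂.zeroCount_le_or with h | ⟨l₃, g₃, hl₃, hg₃, h₃⟩
  · left; omega
  have e₃ := hmul hl₃ h₃
  rcases hg₃.zeroCount_le_or with h | ⟨l₄, g₄, hl₄, hg₄, h₄⟩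
  · left; omega
  right
  obtain ⟨p, hp, hpg⟩ := hg₄
  rw [MvPolynomial.totalDegree_eq_zero_iff_eq_C.1 (Nat.le_zero.1 hp)] at hpg
  simp only [MvPolynomial.eval_C] at hpg
  refine ⟨p.coeff 0, l₁, l₂, l₃, l₄, fun hc => h0 (funext fun v => ?_), hl₁, hl₂, hl₃, hl₄,
    fun v => ?_⟩
  · simp [h₁, h₂, h₃, h₄, hpg, hc]
  · rw [h₁, h₂, h₃, h₄, hpg]
    ring

/-- Weight of a function vanishing exactly on prescribed lines parallel to the axes. -/
theorem weight_eq_of_zero_iff {f : (Fin 2 → F) → F} (A B : Finset F)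
    (h : ∀ x y, f ![x, y] = 0 ↔ x ∈ A ∨ y ∈ B) :
    weight f = (Fintype.card F - A.card) * (Fintype.card F - B.card) := by
  classical
  have h1 : Function.support f =
      ↑((Aᶜ ×ˢ Bᶜ).map (finTwoArrowEquiv F).symm.toEmbedding) := by
    ext v
    have h2 : v = ![v 0, v 1] := by
      ext i
      fin_cases i <;> rfl
    rw [Function.mem_support, ne_eq, h2, h]
    simp
  rw [weight, h1, Set.ncard_coe_finset, Finset.card_map, Finset.card_product,
    Finset.card_compl, Finset.card_compl]

end Count

/-! ### Normal forms and the column-counting bound -/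

/-- Up to an affine transformation, `f` is one of the two products of four lines having exactly
`4 (q - 1)` zeros. -/
def HasProductForm {F : Type*} [Field F] (f : (Fin 2 → F) → F) : Prop :=
  ∃ T : (Fin 2 → F) ≃ᵃ[F] (Fin 2 → F),
    (∃ l a b c d : F, l ≠ 0 ∧ a ≠ b ∧ c ≠ d ∧
      ∀ x y : F, f (T ![x, y]) = l * ((x - a) * (x - b) * (y - c) * (y - d))) ∨
    (∃ (a b : Fin 3 → F) (e : F),
      (∀ i, (a i, b i) ≠ (0, 0)) ∧
      (∀ i j, i ≠ j → a i * b j - a j * b i ≠ 0) ∧ e ≠ 0 ∧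
      ∀ x y : F, f (T ![x, y]) =
        (∏ i, (a i * x + b i * y)) * (a 0 * x + b 0 * y + e))

/-- The possible zero counts of a quartic: the first two, or something smaller, or the third one
with its normal forms. -/
def ZeroCountClassified {F : Type*} [Field F] [Fintype F] (f : (Fin 2 → F) → F) : Prop :=
  zeroCount f = 4 * Fintype.card F ∨ zeroCount f + 3 = 4 * Fintype.card F ∨
    zeroCount f + 5 ≤ 4 * Fintype.card F ∨
    (zeroCount f + 4 ≤ 4 * Fintype.card F ∧ HasProductForm f)

section Classify

variable {F : Type*} [Field F]

theorem HasProductForm.of_comp {f : (Fin 2 → F) → F} (T : (Fin 2 → F) ≃ᵃ[F] (Fin 2 → F))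
    (h : HasProductForm fun v => f (T v)) : HasProductForm f := by
  obtain ⟨S, h⟩ := h
  exact ⟨S.trans T, by simpa using h⟩

theorem hasProductForm_of_concurrent {f : (Fin 2 → F) → F} {l a b a' b' a'' b'' e : F}
    (hl : l ≠ 0) (he : e ≠ 0) (h₁ : a * b' - a' * b ≠ 0) (h₂ : a * b'' - a'' * b ≠ 0)
    (h₃ : a' * b'' - a'' * b' ≠ 0)
    (hf : ∀ v, f v = l * ((a * v 0 + b * v 1) * (a' * v 0 + b' * v 1) *
      (a'' * v 0 + b'' * v 1) * (a * v 0 + b * v 1 + e))) : HasProductForm f := by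
  have h₁' : a * (l * b') - l * a' * b ≠ 0 :=
    fun h => h₁ (mul_left_cancel₀ hl (by linear_combination h))
  have h₃' : l * a' * b'' - a'' * (l * b') ≠ 0 :=
    fun h => h₃ (mul_left_cancel₀ hl (by linear_combination h))
  -- The scalar `l` is absorbed by the second form, which enters once; the first also enters through
  -- its parallel.
  refine ⟨AffineEquiv.refl F _, Or.inr ⟨![a, l * a', a''], ![b, l * b', b''], e, ?_, ?_, he, ?_⟩⟩
  · intro i hi
    rw [Prod.mk.injEq] at hi
    fin_cases i <;> simp only [Fin.zero_eta, Fin.mk_one, Fin.reduceFinMk, Matrix.cons_val] at hi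
    · rw [hi.1, hi.2] at h₁'; simp at h₁'
    · rw [hi.1, hi.2] at h₁'; simp at h₁'
    · rw [hi.1, hi.2] at h₃'; simp at h₃'
  · have hneg : ∀ {x y : F}, x - y ≠ 0 → y - x ≠ 0 := fun {x y} h h' =>
      h (by linear_combination -h')
    intro i j hij
    fin_cases i <;> fin_cases j <;>
      simp only [Fin.zero_eta, Fin.mk_one, Fin.reduceFinMk, Matrix.cons_val, ne_eq,
        not_true_eq_false] at hij ⊢
    · exact h₁'
    · exact h₂
    · exact hneg h₁'
    · exact h₃'
    · exact hneg h₂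
    · exact hneg h₃'
  · intro x y
    simp [hf, Fin.prod_univ_three]
    ring

variable [Fintype F]

theorem ZeroCountClassified.of_comp {f : (Fin 2 → F) → F} (T : (Fin 2 → F) ≃ᵃ[F] (Fin 2 → F))
    (h : ZeroCountClassified fun v => f (T v)) : ZeroCountClassified f := by
  rw [ZeroCountClassified, zeroCount_comp f T] at h
  exact h.imp_right (Or.imp_right (Or.imp_right (And.imp_right (HasProductForm.of_comp T))))

theorem zeroCount_of_zero_iff {f : (Fin 2 → F) → F} (A B : Finset F)
    (h : ∀ x y, f ![x, y] = 0 ↔ x ∈ A ∨ y ∈ B) :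
    zeroCount f + A.card * B.card = Fintype.card F * A.card + Fintype.card F * B.card := by
  have h1 := weight_add_zeroCount f
  rw [weight_eq_of_zero_iff A B h] at h1
  obtain ⟨m, hm⟩ := Nat.exists_eq_add_of_le (Finset.card_le_univ A)
  obtain ⟨n, hn⟩ := Nat.exists_eq_add_of_le (Finset.card_le_univ B)
  have hm' : Fintype.card F - A.card = m := by omega
  have hn' : Fintype.card F - B.card = n := by omega
  rw [hm', hn'] at h1
  zify at *
  have e : (m : ℤ) * n = (Fintype.card F - A.card) * (Fintype.card F - B.card) := by
    rw [hm, ← hm, hn]; ring_nf; rw [show (Fintype.card F : ℤ) = B.card + n from hn] at hm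
    linear_combination (-(n : ℤ)) * hm
  linear_combination h1 - e

/-- If off the line `x = 0` a function vanishes only on three graphs, its number of zeros is
bounded in terms of the coincidences between them. -/
theorem zeroCount_le_of_fibers {f : (Fin 2 → F) → F} (u v w : F → F) (S T : Finset F)
    (h : ∀ x y, x ≠ 0 → f ![x, y] = 0 → y = u x ∨ y = v x ∨ y = w x)
    (hS : ∀ x ∈ S, x ≠ 0 ∧ u x = v x) (hT : ∀ x ∈ T, x ≠ 0 ∧ v x = w x)
    (hq : 9 ≤ Fintype.card F) :
    zeroCount f + 3 + S.card + T.card ≤ 4 * Fintype.card F := by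
  classical
  -- The total without coincidences is `3(q - 1) + q = 4q - 3`. Both coincidences involve `v`, so a
  -- column in `S ∩ T` has a single value left and the two savings still add up.
  have key : ∀ x, {y | f ![x, y] = 0}.ncard + (if x ∈ S then 1 else 0) + (if x ∈ T then 1 else 0)
      ≤ 3 + if x = 0 then Fintype.card F - 3 else 0 := fun x => by
    by_cases hx : x = 0
    · have h1 : x ∉ S := fun hs => (hS x hs).1 hx
      have h2 : x ∉ T := fun hs => (hT x hs).1 hx
      have h3 : {y | f ![x, y] = 0}.ncard ≤ Fintype.card F := by
        rw [← Nat.card_eq_fintype_card]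
        exact Set.ncard_le_card _
      rw [if_neg h1, if_neg h2, if_pos hx]
      omega
    · have h1 : {y | f ![x, y] = 0}.ncard ≤ ({u x, v x, w x} : Finset F).card := by
        rw [← Set.ncard_coe_finset]
        refine Set.ncard_le_ncard fun y hy => ?_
        simpa using h x y hx hy
      simp only [hx, if_false]
      refine le_trans (add_le_add_left (add_le_add_left h1 _) _) ?_
      split_ifs with h2 h3 h3
      · simp [(hS x h2).2, (hT x h3).2]
      · have := Finset.card_le_two (a := v x) (b := w x)
        simpa [(hS x h2).2, Nat.lt_succ_iff] using this
      · have := Finset.card_le_two (a := u x) (b := w x)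
        simpa [(hT x h3).2, Nat.lt_succ_iff] using this
      · exact Finset.card_le_three
  have hsum := Finset.sum_le_sum fun x (_ : x ∈ Finset.univ) => key x
  simp only [Finset.sum_add_distrib, ← zeroCount_eq_sum, Finset.sum_ite_eq', Finset.sum_ite_mem,
    Finset.univ_inter, Finset.sum_const, Finset.card_univ, Finset.mem_univ, if_true,
    smul_eq_mul, mul_one] at hsum
  omega

end Classify

/-! ### Classification of products of four lines -/

section Classify

variable {F : Type*} [Field F]

/-- A line not parallel to the `y` axis is a graph. -/
theorem eq_neg_div_of_line {a b c x y : F} (hb : b ≠ 0) (h : a * x + b * y + c = 0) :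
    y = -(a * x + c) / b := by
  field_simp
  linear_combination h

/-- The affine transformation exchanging the coordinates. -/
theorem exists_affineEquiv_swap :
    ∃ T : (Fin 2 → F) ≃ᵃ[F] (Fin 2 → F), ∀ v, T v 0 = v 1 ∧ T v 1 = v 0 := by
  obtain ⟨T, hT⟩ := exists_affineEquiv (0 : F) 1 0 1 0 0 (by simp)
  exact ⟨T, fun v => ⟨by simpa using (hT v).2, by simpa using (hT v).1⟩⟩

variable [Fintype F]

/-- Disposes of repeated lines: `3q ≤ 4q - 5`. -/
theorem zeroCountClassified_of_three_lines (hq : 9 ≤ Fintype.card F) {f l₁ l₂ l₃ : (Fin 2 → F) → F}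
    (h₁ : IsLine l₁) (h₂ : IsLine l₂) (h₃ : IsLine l₃)
    (h : ∀ v, f v = 0 → l₁ v * l₂ v * l₃ v = 0) : ZeroCountClassified f := by
  have e₁ := zeroCount_mono h
  have e₂ := zeroCount_mul_le (fun v => l₁ v * l₂ v) l₃
  have e₃ := zeroCount_mul_le l₁ l₂
  rw [h₁.zeroCount_eq, h₂.zeroCount_eq] at e₃
  rw [h₃.zeroCount_eq] at e₂
  exact Or.inr (Or.inr (Or.inl (by omega)))

theorem zeroCountClassified_of_parallel (hq : 9 ≤ Fintype.card F) {f : (Fin 2 → F) → F}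
    {l a b c d : F} (hl : l ≠ 0)
    (hf : ∀ v, f v = l * ((v 0 - a) * (v 0 - b) * (v 0 - c) * (v 0 - d))) :
    ZeroCountClassified f := by
  classical
  have h := zeroCount_of_zero_iff (f := f) {a, b, c, d} ∅ fun x y => by
    simp [hf, hl, sub_eq_zero, or_assoc]
  have h4 := Finset.card_le_four (a := a) (b := b) (c := c) (d := d)
  simp only [Finset.card_empty, mul_zero, add_zero] at h
  rcases h4.eq_or_lt with h4 | h4
  · left
    rw [h, h4, mul_comm]
  · right; right; left
    nlinarith

theorem zeroCountClassified_of_three_one (hq : 9 ≤ Fintype.card F) {f : (Fin 2 → F) → F}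
    {l a b c d : F} (hl : l ≠ 0)
    (hf : ∀ v, f v = l * ((v 0 - a) * (v 0 - b) * (v 0 - c) * (v 1 - d))) :
    ZeroCountClassified f := by
  classical
  have h := zeroCount_of_zero_iff (f := f) {a, b, c} {d} fun x y => by
    simp [hf, hl, sub_eq_zero, or_assoc]
  have h3 := Finset.card_le_three (a := a) (b := b) (c := c)
  simp only [Finset.card_singleton, mul_one] at h
  rcases h3.eq_or_lt with h3 | h3
  · right; left
    rw [h3] at h
    omega
  · right; right; left
    nlinarith

theorem zeroCountClassified_of_two_two (hq : 9 ≤ Fintype.card F) {f : (Fin 2 → F) → F}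
    {l a b c d : F} (hl : l ≠ 0)
    (hf : ∀ v, f v = l * ((v 0 - a) * (v 0 - b) * (v 1 - c) * (v 1 - d))) :
    ZeroCountClassified f := by
  classical
  by_cases hab : a = b
  · subst hab
    refine zeroCountClassified_of_three_lines hq (isLine_fst_sub a) (isLine_snd_sub c)
      (isLine_snd_sub d) fun v hv => ?_
    rw [hf] at hv
    simp only [mul_eq_zero, hl, false_or] at hv ⊢
    tauto
  by_cases hcd : c = d
  · subst hcd
    refine zeroCountClassified_of_three_lines hq (isLine_fst_sub a) (isLine_fst_sub b)
      (isLine_snd_sub c) fun v hv => ?_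
    rw [hf] at hv
    simp only [mul_eq_zero, hl, false_or] at hv ⊢
    tauto
  have h := zeroCount_of_zero_iff (f := f) {a, b} {c, d} fun x y => by
    simp [hf, hl, sub_eq_zero, or_assoc]
  rw [Finset.card_pair hab, Finset.card_pair hcd] at h
  exact Or.inr (Or.inr (Or.inr ⟨by omega, AffineEquiv.refl F _,
    Or.inl ⟨l, a, b, c, d, hl, hab, hcd, fun x y => by simp [hf]⟩⟩))

/-- The skew line meets `y = 0` and `y = s` at two points, each saving one zero unless it lies on `x
= 0`. For `s ≠ 0` at most one does, and then three lines concur there while the fourth is parallel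
to one of them. -/
theorem zeroCountClassified_of_parallel_pair (hq : 9 ≤ Fintype.card F) {f : (Fin 2 → F) → F}
    {l s a b c : F} (hl : l ≠ 0) (ha : a ≠ 0) (hb : b ≠ 0)
    (hf : ∀ v, f v = l * (v 0 * v 1 * (v 1 - s) * (a * v 0 + b * v 1 + c))) :
    ZeroCountClassified f := by
  by_cases hs : s = 0
  · subst hs
    refine zeroCountClassified_of_three_lines hq (isLine_fst_sub 0) (isLine_snd_sub 0)
      (isLine_of_coeff a b c (Or.inl ha)) fun v hv => ?_
    rw [hf] at hv
    simp only [mul_eq_zero, hl, false_or, sub_zero] at hv ⊢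
    tauto
  have bound := zeroCount_le_of_fibers (f := f) (fun _ => 0) (fun x => -(a * x + c) / b)
    (fun _ => s)
  have hfib : ∀ x y, x ≠ 0 → f ![x, y] = 0 → y = 0 ∨ y = -(a * x + c) / b ∨ y = s := by
    intro x y hx hxy
    simp only [hf, Matrix.cons_val_zero, Matrix.cons_val_one, mul_eq_zero, hl, hx, false_or,
      sub_eq_zero] at hxy
    rcases hxy with (h | h) | h
    · exact Or.inl h
    · exact Or.inr (Or.inr h)
    · exact Or.inr (Or.inl (eq_neg_div_of_line hb h))
  have hS : c ≠ 0 → ∀ x ∈ ({-c / a} : Finset F), x ≠ 0 ∧ 0 = -(a * x + c) / b := by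
    intro hc x hx
    rw [Finset.mem_singleton.1 hx]
    exact ⟨div_ne_zero (neg_ne_zero.2 hc) ha, by field_simp; ring⟩
  have hT : c + b * s ≠ 0 → ∀ x ∈ ({-(c + b * s) / a} : Finset F),
      x ≠ 0 ∧ -(a * x + c) / b = s := by
    intro hc x hx
    rw [Finset.mem_singleton.1 hx]
    exact ⟨div_ne_zero (neg_ne_zero.2 hc) ha, by field_simp; ring⟩
  by_cases hc : c = 0
  · have h := bound ∅ _ hfib (by simp) (hT (by simp [hc, hb, hs])) hq
    rw [Finset.card_empty, Finset.card_singleton] at h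
    refine Or.inr (Or.inr (Or.inr ⟨by omega, ?_⟩))
    refine hasProductForm_of_concurrent (l := l) (a := 0) (b := 1) (a' := 1) (b' := 0)
      (a'' := a) (b'' := b) (e := -s) hl (neg_ne_zero.2 hs) (by simp) (by simpa using ha)
      (by simpa using hb) fun v => ?_
    rw [hf, hc]
    ring
  by_cases hcs : c + b * s = 0
  · have h := bound _ ∅ hfib (hS hc) (by simp) hq
    rw [Finset.card_empty, Finset.card_singleton] at h
    refine Or.inr (Or.inr (Or.inr ⟨by omega, ?_⟩))
    refine HasProductForm.of_comp (AffineEquiv.constVAdd F (Fin 2 → F) ![0, s]) ?_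
    refine hasProductForm_of_concurrent (l := l) (a := 0) (b := 1) (a' := 1) (b' := 0)
      (a'' := a) (b'' := b) (e := s) hl hs (by simp) (by simpa using ha)
      (by simpa using hb) fun v => ?_
    simp only [hf, AffineEquiv.constVAdd_apply, vadd_eq_add, Pi.add_apply, Matrix.cons_val_zero,
      Matrix.cons_val_one]
    linear_combination l * (v 0 * (v 1 + s) * v 1) * hcs
  · have h := bound _ _ hfib (hS hc) (hT hcs) hq
    rw [Finset.card_singleton, Finset.card_singleton] at h
    exact Or.inr (Or.inr (Or.inl (by omega)))

theorem zeroCountClassified_of_concurrent (hq : 9 ≤ Fintype.card F) {f : (Fin 2 → F) → F}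
    {l a b a' b' : F} (hl : l ≠ 0) (ha : a ≠ 0) (hb : b ≠ 0) (ha' : a' ≠ 0) (hb' : b' ≠ 0)
    (hf : ∀ v, f v = l * (v 0 * v 1 * (a * v 0 + b * v 1) * (a' * v 0 + b' * v 1))) :
    ZeroCountClassified f := by
  classical
  by_cases hD : a * b' - a' * b = 0
  · refine zeroCountClassified_of_three_lines hq (isLine_fst_sub 0) (isLine_snd_sub 0)
      (isLine_of_coeff a b 0 (Or.inl ha)) fun v hv => ?_
    have h' : a * (a' * v 0 + b' * v 1) = a' * (a * v 0 + b * v 1) := by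
      linear_combination v 1 * hD
    have h'' : a' * v 0 + b' * v 1 = 0 → a * v 0 + b * v 1 = 0 := fun h0 => by
      rw [h0, mul_zero] at h'
      exact (mul_eq_zero.1 h'.symm).resolve_left ha'
    rw [hf] at hv
    simp only [mul_eq_zero, hl, false_or, sub_zero, add_zero] at hv ⊢
    tauto
  right; left
  -- Four distinct concurrent lines: the column `x = 0` is full and every other one has exactly
  -- three zeros, `4q - 3` in all.
  have key : ∀ x, {y | f ![x, y] = 0}.ncard = 3 + if x = 0 then Fintype.card F - 3 else 0 := by
    intro x
    by_cases hx : x = 0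
    · simp [hf, hx, Set.ncard_univ]
      omega
    · have hset : {y | f ![x, y] = 0} = ↑({0, -(a * x) / b, -(a' * x) / b'} : Finset F) := by
        ext y
        simp only [hf, Matrix.cons_val_zero, Matrix.cons_val_one, mul_eq_zero, hl, hx, false_or,
          Set.mem_ofPred_eq, Finset.coe_insert, Finset.coe_singleton, Set.mem_insert_iff,
          Set.mem_singleton_iff, or_assoc, eq_div_iff hb, eq_div_iff hb']
        refine or_congr Iff.rfl (or_congr ?_ ?_)
        · exact ⟨fun h => by linear_combination h, fun h => by linear_combination h⟩
        · exact ⟨fun h => by linear_combination h, fun h => by linear_combination h⟩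
      rw [hset, Set.ncard_coe_finset, if_neg hx, Finset.card_eq_three.2 ⟨_, _, _, ?_, ?_, ?_, rfl⟩]
      · exact (div_ne_zero (neg_ne_zero.2 (mul_ne_zero ha hx)) hb).symm
      · exact (div_ne_zero (neg_ne_zero.2 (mul_ne_zero ha' hx)) hb').symm
      · intro h
        rw [div_eq_div_iff hb hb'] at h
        exact hD (mul_left_cancel₀ hx (by linear_combination -h))
  rw [zeroCount_eq_sum, Finset.sum_congr rfl fun x _ => key x]
  simp only [Finset.sum_add_distrib, Finset.sum_ite_eq', Finset.sum_const, Finset.card_univ,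
    Finset.mem_univ, if_true, smul_eq_mul]
  omega

theorem zeroCountClassified_of_concurrent_triple (hq : 9 ≤ Fintype.card F) {f : (Fin 2 → F) → F}
    {l a b a' b' c : F} (hl : l ≠ 0) (ha : a ≠ 0) (hb : b ≠ 0) (ha' : a' ≠ 0) (hb' : b' ≠ 0)
    (hc : c ≠ 0)
    (hf : ∀ v, f v = l * (v 0 * v 1 * (a * v 0 + b * v 1) * (a' * v 0 + b' * v 1 + c))) :
    ZeroCountClassified f := by
  have bound := zeroCount_le_of_fibers (f := f) (fun _ => 0) (fun x => -(a' * x + c) / b')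
    (fun x => -(a * x + 0) / b)
  have hfib : ∀ x y, x ≠ 0 → f ![x, y] = 0 →
      y = 0 ∨ y = -(a' * x + c) / b' ∨ y = -(a * x + 0) / b := by
    intro x y hx hxy
    simp only [hf, Matrix.cons_val_zero, Matrix.cons_val_one, mul_eq_zero, hl, hx,
      false_or] at hxy
    rcases hxy with (h | h) | h
    · exact Or.inl h
    · exact Or.inr (Or.inr (eq_neg_div_of_line hb (by linear_combination h)))
    · exact Or.inr (Or.inl (eq_neg_div_of_line hb' h))
  have hS : ∀ x ∈ ({-c / a'} : Finset F), x ≠ 0 ∧ 0 = -(a' * x + c) / b' := by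
    intro x hx
    rw [Finset.mem_singleton.1 hx]
    exact ⟨div_ne_zero (neg_ne_zero.2 hc) ha', by field_simp; ring⟩
  by_cases hD : a * b' - a' * b = 0
  · have h := bound _ ∅ hfib hS (by simp) hq
    rw [Finset.card_empty, Finset.card_singleton] at h
    refine Or.inr (Or.inr (Or.inr ⟨by omega, ?_⟩))
    -- Here the fourth line is parallel to the third: its equation is `a' / a` times `a x + b y + c
    -- a / a'`.
    refine hasProductForm_of_concurrent (l := l * (a' / a)) (a := a) (b := b) (a' := 1) (b' := 0)
      (a'' := 0) (b'' := 1) (e := c * a / a') (mul_ne_zero hl (div_ne_zero ha' ha))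
      (div_ne_zero (mul_ne_zero hc ha) ha') (by simpa using hb) (by simpa using ha)
      (by simp) fun v => ?_
    have hb'' : b' = a' * b / a := by
      field_simp
      linear_combination hD
    rw [hf, hb'']
    field_simp
    ring
  -- The abscissa at which the third and fourth lines meet; it is nonzero because `c ≠ 0`.
  · have h := bound _ {c * b / (a * b' - a' * b)} hfib hS (by
      intro x hx
      rw [Finset.mem_singleton.1 hx]
      refine ⟨div_ne_zero (mul_ne_zero hc hb) hD, ?_⟩
      field_simp
      ring) hq
    rw [Finset.card_singleton, Finset.card_singleton] at h
    exact Or.inr (Or.inr (Or.inl (by omega)))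

/-- Both skew lines meet `y = 0` away from the origin, so taking `y = 0` as the middle graph always
saves two zeros. -/
theorem zeroCountClassified_of_skew_pair (hq : 9 ≤ Fintype.card F) {f : (Fin 2 → F) → F}
    {l a b c a' b' c' : F} (hl : l ≠ 0) (ha : a ≠ 0) (hb : b ≠ 0) (ha' : a' ≠ 0) (hb' : b' ≠ 0)
    (hc : c ≠ 0) (hc' : c' ≠ 0)
    (hf : ∀ v, f v = l * (v 0 * v 1 * (a * v 0 + b * v 1 + c) * (a' * v 0 + b' * v 1 + c'))) :
    ZeroCountClassified f := by
  have h := zeroCount_le_of_fibers (f := f) (fun x => -(a * x + c) / b) (fun _ => 0)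
    (fun x => -(a' * x + c') / b') {-c / a} {-c' / a'} (by
      intro x y hx hxy
      simp only [hf, Matrix.cons_val_zero, Matrix.cons_val_one, mul_eq_zero, hl, hx,
        false_or] at hxy
      rcases hxy with (h | h) | h
      · exact Or.inr (Or.inl h)
      · exact Or.inl (eq_neg_div_of_line hb h)
      · exact Or.inr (Or.inr (eq_neg_div_of_line hb' h))) (by
      intro x hx
      rw [Finset.mem_singleton.1 hx]
      exact ⟨div_ne_zero (neg_ne_zero.2 hc) ha, by field_simp; ring⟩) (by
      intro x hx
      rw [Finset.mem_singleton.1 hx]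
      exact ⟨div_ne_zero (neg_ne_zero.2 hc') ha', by field_simp; ring⟩) hq
  rw [Finset.card_singleton, Finset.card_singleton] at h
  exact Or.inr (Or.inr (Or.inl (by omega)))

theorem zeroCountClassified_of_axes_mul_skew (hq : 9 ≤ Fintype.card F) {f : (Fin 2 → F) → F}
    {l a b c a' b' c' : F} (hl : l ≠ 0) (hab : a ≠ 0 ∨ b ≠ 0) (ha' : a' ≠ 0) (hb' : b' ≠ 0)
    (hf : ∀ v, f v = l * (v 0 * v 1 * (a * v 0 + b * v 1 + c) * (a' * v 0 + b' * v 1 + c'))) :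
    ZeroCountClassified f := by
  by_cases ha : a = 0
  · subst ha
    have hb : b ≠ 0 := by simpa using hab
    refine zeroCountClassified_of_parallel_pair hq (l := l * b) (s := -c / b)
      (mul_ne_zero hl hb) ha' hb' (c := c') fun v => ?_
    rw [hf]
    field_simp
    ring
  by_cases hb : b = 0
  · subst hb
    obtain ⟨T, hT⟩ := exists_affineEquiv_swap (F := F)
    refine ZeroCountClassified.of_comp T ?_
    refine zeroCountClassified_of_parallel_pair hq (l := l * a) (s := -c / a)
      (mul_ne_zero hl ha) hb' ha' (c := c') fun v => ?_
    rw [hf, (hT v).1, (hT v).2]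
    field_simp
    ring
  by_cases hc : c = 0
  · subst hc
    by_cases hc' : c' = 0
    · subst hc'
      exact zeroCountClassified_of_concurrent hq hl ha hb ha' hb' (by simpa using hf)
    · exact zeroCountClassified_of_concurrent_triple hq hl ha hb ha' hb' hc' (by simpa using hf)
  by_cases hc' : c' = 0
  · subst hc'
    exact zeroCountClassified_of_concurrent_triple hq hl ha' hb' ha hb hc
      fun v => by rw [hf]; ring
  exact zeroCountClassified_of_skew_pair hq hl ha hb ha' hb' hc hc' hf

theorem zeroCountClassified_of_axes_mul (hq : 9 ≤ Fintype.card F) {f g h : (Fin 2 → F) → F}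
    {l : F} (hl : l ≠ 0) (hg : IsLine g) (hh : IsLine h)
    (hf : ∀ v, f v = l * (v 0 * v 1 * g v * h v)) : ZeroCountClassified f := by
  obtain ⟨a, b, c, hab, hg⟩ := hg
  obtain ⟨a', b', c', hab', hh⟩ := hh
  simp only [hg, hh] at hf
  by_cases h₁ : a' ≠ 0 ∧ b' ≠ 0
  · exact zeroCountClassified_of_axes_mul_skew hq hl hab h₁.1 h₁.2 hf
  by_cases h₂ : a ≠ 0 ∧ b ≠ 0
  · exact zeroCountClassified_of_axes_mul_skew hq (c := c') (c' := c) hl hab' h₂.1 h₂.2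
      fun v => by rw [hf]; ring
  obtain ⟨T, hT⟩ := exists_affineEquiv_swap (F := F)
  by_cases ha : a = 0
  · subst ha
    have hb : b ≠ 0 := by simpa using hab
    by_cases ha' : a' = 0
    · subst ha'
      have hb' : b' ≠ 0 := by simpa using hab'
      refine ZeroCountClassified.of_comp T ?_
      refine zeroCountClassified_of_three_one hq (l := l * b * b') (a := 0) (b := -c / b)
        (c := -c' / b') (d := 0) (by simp [hl, hb, hb']) fun v => ?_
      rw [hf, (hT v).1, (hT v).2]
      field_simp
      ring
    · have hb' : b' = 0 := by tauto
      subst hb'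
      refine zeroCountClassified_of_two_two hq (l := l * b * a') (a := 0) (b := -c' / a')
        (c := 0) (d := -c / b) (by simp [hl, hb, ha']) fun v => ?_
      rw [hf]
      field_simp
      ring
  · have hb : b = 0 := by tauto
    subst hb
    by_cases ha' : a' = 0
    · subst ha'
      have hb' : b' ≠ 0 := by simpa using hab'
      refine zeroCountClassified_of_two_two hq (l := l * a * b') (a := 0) (b := -c / a)
        (c := 0) (d := -c' / b') (by simp [hl, ha, hb']) fun v => ?_
      rw [hf]
      field_simp
      ring
    · have hb' : b' = 0 := by tauto
      subst hb'
      refine zeroCountClassified_of_three_one hq (l := l * a * a') (a := 0) (b := -c / a)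
        (c := -c' / a') (d := 0) (by simp [hl, ha, ha']) fun v => ?_
      rw [hf]
      field_simp
      ring

theorem zeroCountClassified_of_lines (hq : 9 ≤ Fintype.card F) {f l₁ l₂ l₃ l₄ : (Fin 2 → F) → F}
    {l : F} (hl : l ≠ 0) (h₁ : IsLine l₁) (h₂ : IsLine l₂) (h₃ : IsLine l₃) (h₄ : IsLine l₄)
    (hf : ∀ v, f v = l * (l₁ v * l₂ v * l₃ v * l₄ v)) : ZeroCountClassified f := by
  obtain ⟨T, hT⟩ := h₁.exists_comp_eq_fst
  refine ZeroCountClassified.of_comp T ?_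
  replace h₂ := h₂.comp T
  replace h₃ := h₃.comp T
  replace h₄ := h₄.comp T
  have hf' : ∀ v, f (T v) = l * (v 0 * l₂ (T v) * l₃ (T v) * l₄ (T v)) := fun v => by
    rw [hf, hT]
  -- With the first line equal to `x = 0`, any line with `b ≠ 0` is transversal to it and can be
  -- made `y = 0`; if there is none, all four are parallel.
  have key : ∀ {g g' g'' : (Fin 2 → F) → F} {a b c : F}, IsLine g' → IsLine g'' →
      (∀ v, g v = a * v 0 + b * v 1 + c) → b ≠ 0 →
      (∀ v, f (T v) = l * (v 0 * g v * g' v * g'' v)) →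
      ZeroCountClassified fun v => f (T v) := by
    intro g g' g'' a b c hg' hg'' hg hb hfg
    obtain ⟨S, hS⟩ := exists_affineEquiv 1 0 0 a b c (by simpa using hb)
    refine ZeroCountClassified.of_comp S ?_
    refine zeroCountClassified_of_axes_mul hq hl (hg'.comp S) (hg''.comp S) fun v => ?_
    have h0 := (hS v).1
    simp only [one_mul, zero_mul, add_zero] at h0
    rw [hfg, hg, (hS v).2, h0]
  have h₂' := h₂
  have h₃' := h₃
  have h₄' := h₄
  obtain ⟨a₂, b₂, c₂, hab₂, h₂⟩ := h₂
  obtain ⟨a₃, b₃, c₃, hab₃, h₃⟩ := h₃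
  obtain ⟨a₄, b₄, c₄, hab₄, h₄⟩ := h₄
  by_cases hb₂ : b₂ = 0
  swap
  · exact key h₃' h₄' h₂ hb₂ hf'
  by_cases hb₃ : b₃ = 0
  swap
  · exact key h₂' h₄' h₃ hb₃ fun v => by rw [hf']; ring
  by_cases hb₄ : b₄ = 0
  swap
  · exact key h₂' h₃' h₄ hb₄ fun v => by rw [hf']; ring
  subst hb₂ hb₃ hb₄
  beta_reduce at h₂ h₃ h₄
  have ha₂ : a₂ ≠ 0 := by simpa using hab₂
  have ha₃ : a₃ ≠ 0 := by simpa using hab₃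
  have ha₄ : a₄ ≠ 0 := by simpa using hab₄
  refine zeroCountClassified_of_parallel hq (l := l * a₂ * a₃ * a₄) (a := 0) (b := -c₂ / a₂)
    (c := -c₃ / a₃) (d := -c₄ / a₄) (by simp [hl, ha₂, ha₃, ha₄]) fun v => ?_
  simp only [hf', h₂, h₃, h₄]
  field_simp
  ring

theorem IsPolyFun.zeroCountClassified (hq : 9 ≤ Fintype.card F) {f : (Fin 2 → F) → F}
    (hf : IsPolyFun 4 f) (h0 : f ≠ 0) : ZeroCountClassified f := by
  rcases hf.zeroCount_le_or_eq_prod_lines h0 with h | ⟨c, l₁, l₂, l₃, l₄, hc, h₁, h₂, h₃, h₄, h⟩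
  · exact Or.inr (Or.inr (Or.inl (by omega)))
  · exact zeroCountClassified_of_lines hq hc h₁ h₂ h₃ h₄ h

/-- There are quartics realizing each of the three smallest weights. -/
theorem isWeight_of_axis_parallel (hq : 9 ≤ Fintype.card F) {m n : ℕ} (hmn : m + n = 4) :
    IsWeight F 4 2 ((Fintype.card F - m) * (Fintype.card F - n)) := by
  classical
  have hex : ∀ k ≤ 4, ∃ A : Finset F, A.card = k := fun k hk => by
    obtain ⟨A, -, hA⟩ := Finset.exists_subset_card_eq (s := (Finset.univ : Finset F)) (n := k)
      (by rw [Finset.card_univ]; omega)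
    exact ⟨A, hA⟩
  have hpoly : ∀ (l : F → (Fin 2 → F) → F), (∀ a, IsLine (l a)) → ∀ A : Finset F,
      IsPolyFun A.card fun v => ∏ a ∈ A, l a v := fun l hl A => by
    induction A using Finset.induction_on with
    | empty => simpa using isPolyFun_const 0 (1 : F)
    | insert a A ha ih =>
      simp only [Finset.prod_insert ha, Finset.card_insert_of_notMem ha]
      rw [add_comm]
      exact (hl a).isPolyFun.mul ih
  obtain ⟨A, hA⟩ := hex m (by omega)
  obtain ⟨B, hB⟩ := hex n (by omega)
  let f : (Fin 2 → F) → F := fun v => (∏ a ∈ A, (v 0 - a)) * ∏ b ∈ B, (v 1 - b)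
  have hw : weight f = (Fintype.card F - m) * (Fintype.card F - n) := by
    rw [← hA, ← hB]
    refine weight_eq_of_zero_iff A B fun x y => ?_
    simp [f, Finset.prod_eq_zero_iff, sub_eq_zero]
  refine ⟨f, (mem_reedMuller_iff (by omega)).2 ?_, fun h0 => ?_, hw⟩
  · rw [← hmn, ← hA, ← hB]
    exact (hpoly _ isLine_fst_sub A).mul (hpoly _ isLine_snd_sub B)
  · rw [h0] at hw
    have : 0 < (Fintype.card F - m) * (Fintype.card F - n) :=
      Nat.mul_pos (by omega) (by omega)
    simp [weight] at hw
    omega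

end Classify

/-! ### From zero counts to the third weight -/

theorem mainTheorem7 {F : Type*} [Field F] [Fintype F] (hq : 9 ≤ Fintype.card F) :
    thirdWeight F 4 2 = (Fintype.card F - 2) ^ 2 ∧
    ∀ f ∈ reedMuller F 4 2, weight f = (Fintype.card F - 2) ^ 2 →
      ∃ T : (Fin 2 → F) ≃ᵃ[F] (Fin 2 → F),
        (∃ l a b c d : F, l ≠ 0 ∧ a ≠ b ∧ c ≠ d ∧
          ∀ x y : F, f (T ![x, y]) = l * ((x - a) * (x - b) * (y - c) * (y - d))) ∨
        (∃ (a b : Fin 3 → F) (e : F),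
          (∀ i, (a i, b i) ≠ (0, 0)) ∧
          (∀ i j, i ≠ j → a i * b j - a j * b i ≠ 0) ∧ e ≠ 0 ∧
          ∀ x y : F, f (T ![x, y]) =
            (∏ i, (a i * x + b i * y)) * (a 0 * x + b 0 * y + e)) := by
  classical
  -- Writing `q = 9 + k` removes the truncated subtractions.
  obtain ⟨k, hk⟩ := Nat.exists_eq_add_of_le hq
  have hq2 : Fintype.card F - 2 = k + 7 := by omega
  have hw4 : IsWeight F 4 2 ((k + 5) * (k + 9)) := by
    have := isWeight_of_axis_parallel hq (m := 4) (n := 0) rfl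
    rwa [show Fintype.card F - 4 = k + 5 by omega, show Fintype.card F - 0 = k + 9 by omega] at this
  have hw3 : IsWeight F 4 2 ((k + 6) * (k + 8)) := by
    have := isWeight_of_axis_parallel hq (m := 3) (n := 1) rfl
    rwa [show Fintype.card F - 3 = k + 6 by omega, show Fintype.card F - 1 = k + 8 by omega] at this
  have hw2 : IsWeight F 4 2 ((k + 7) ^ 2) := by
    have := isWeight_of_axis_parallel hq (m := 2) (n := 2) rfl
    rwa [hq2, ← sq] at this
  rw [hq2]
  constructor
  -- Since `Nat.nth` counts from zero, it suffices that exactly two weights lie below the weight `(q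
  -- - 2)²`.
  · have hcount : Nat.count (IsWeight F 4 2) ((k + 7) ^ 2) = 2 := by
      have hfilter : (Finset.range ((k + 7) ^ 2)).filter (IsWeight F 4 2) =
          {(k + 5) * (k + 9), (k + 6) * (k + 8)} := by
        ext w
        simp only [Finset.mem_filter, Finset.mem_range, Finset.mem_insert, Finset.mem_singleton]
        constructor
        · rintro ⟨hlt, f, hf, hf0, rfl⟩
          have hsum := weight_add_zeroCount f
          rw [hk] at hsum
          rcases ((mem_reedMuller_iff (by omega)).1 hf).zeroCountClassified hq hf0 with
            h | h | h | ⟨h, -⟩ <;> rw [hk] at h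
          · left; nlinarith
          · right; nlinarith
          · nlinarith
          · nlinarith
        · rintro (rfl | rfl)
          · exact ⟨by nlinarith, hw4⟩
          · exact ⟨by nlinarith, hw3⟩
      rw [Nat.count_eq_card_filter_range, hfilter, Finset.card_pair (by nlinarith)]
    have hnth := Nat.nth_count hw2
    rwa [hcount] at hnth
  · intro f hf hwf
    have hf0 : f ≠ 0 := by
      rintro rfl
      simp only [weight, Function.support_zero, Set.ncard_empty] at hwf
      nlinarith
    have hsum := weight_add_zeroCount f
    rw [hk] at hsum
    rcases ((mem_reedMuller_iff (by omega)).1 hf).zeroCountClassified hq hf0 with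
      h | h | h | ⟨-, h⟩
    · rw [hk] at h; nlinarith
    · rw [hk] at h; nlinarith
    · rw [hk] at h; nlinarith
    · exact h
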